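/- Let $K$ be a field and let $B$ be a simplicial affine semigroup, i.e. a finitely generated submonoid of $(\mathbb Z^n,+)$ for which there are linearly independent elements $e_1,\dots,e_d\in B$ with $C(\{e_1,\dots,e_d\})=C(B)$, where $C(X)\subseteq\mathbb Q^n$ denotes the set of all finite sums $\sum_i\lambda_i x_i$ with $\lambda_i\in\mathbb Q_{\ge 0}$, $x_i\in X$. Fix such $e_1,\dots,e_d$. Let $A$ be the submonoid of $B$ generated by $e_1,\dots,e_d$, let $G(A)$ be the group generated by $A$, let $K[B]$ and $T:=K[A]$ be the semigroup rings over $K$, with monomials $t^b$, and for $x\in B$ let $\lambda_1^x,\dots,\lambda_d^x\in\mathbb Q$ be the unique rational numbers with $x=\sum_{i=1}^d\lambda_i^xe_i$. Put $$B_A:=\{x\in B\mid x-a\notin B\ \text{for all } a\in A\setminus\{0\}\},$$ and let $\Gamma_1,\dots,\Gamma_f$ be the (finitely many, pairwise distinct) equivalence classes on $B_A$ of the relation $x\sim y:\Leftrightarrow x-y\in G(A)$. For $j=1,\dots,f$ set $$h_j:=\sum_{i=1}^d\min\{\lambda_i^x\mid x\in\Gamma_j\}\,e_i ,$$ so that $x-h_j\in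 A$ for all $x\in\Gamma_j$, and let $I_j$ be the monomial ideal of $T$ generated by the monomials $t^{x-h_j}$, $x\in\Gamma_j$. Then the following assertions are equivalent: 1. The ring $K[B]$ is Cohen–Macaulay (it is Noetherian, and at every maximal ideal its localization has depth equal to its Krull dimension). 2. There exist $\gamma_1,\dots,\gamma_f\in B$ (with $f$ the number of equivalence classes above) such that every $x\in B$ has a representation $x=\gamma_j+\sum_{i=1}^d n_ie_i$ for some $j\in\{1,\dots,f\}$ and some $n_1,\dots,n_d\in\mathbb N=\{0,1,2,\dots\}$. 3. $\#\Gamma_j=1$ for all $j=1,\dots,f$. 4. $I_j=T$ for all $j=1,\dots,f$. -/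

import Mathlib

open RingTheory.Sequence

noncomputable section

namespace CohenMacaulay

/-- The depth of a local ring `R`: the supremum of the lengths of the `R`-regular sequences
contained in the maximal ideal. -/
def depth (R : Type*) [CommRing R] [IsLocalRing R] : ℕ∞ :=
  ⨆ (rs : List R) (_ : (∀ r ∈ rs, r ∈ IsLocalRing.maximalIdeal R) ∧ IsRegular R rs),
    (rs.length : ℕ∞)

/-- A Noetherian local ring is Cohen-Macaulay if its depth equals its Krull dimension. -/
def IsCohenMacaulayLocalRing (R : Type*) [CommRing R] [IsLocalRing R] : Prop :=
  IsNoetherianRing R ∧ (depth R : WithBot ℕ∞) = ringKrullDim R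

/-- A commutative ring is Cohen-Macaulay if it is Noetherian and its localization at every
maximal ideal is a Cohen-Macaulay local ring. -/
def IsCohenMacaulayRing (R : Type*) [CommRing R] : Prop :=
  IsNoetherianRing R ∧
    ∀ (m : Ideal R) [m.IsMaximal], IsCohenMacaulayLocalRing (Localization.AtPrime m)

end CohenMacaulay

namespace AffineSemigroup

variable {n d : ℕ}

/-- The inclusion `ℤⁿ ⊆ ℚⁿ`. -/
def toQ (x : Fin n → ℤ) : Fin n → ℚ := fun k => (x k : ℚ)

/-- The rational cone `C(X)`, the set of all finite sums `∑ λᵢ xᵢ` with `xᵢ ∈ X` and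
`λᵢ ∈ ℚ`, `λᵢ ≥ 0`, spanned by a set `X` of lattice points. -/
def cone (X : Set (Fin n → ℤ)) : PointedCone ℚ (Fin n → ℚ) :=
  PointedCone.hull ℚ (toQ '' X)

/-- `B` is an affine semigroup (a finitely generated submonoid of `ℤⁿ`) which is simplicial,
as witnessed by the linearly independent elements `e₁, …, e_d` of `B`, which span the same
cone as `B`. -/
structure IsSimplicial (B : AddSubmonoid (Fin n → ℤ)) (e : Fin d → Fin n → ℤ) : Prop where
  fg : B.FG
  mem : ∀ i, e i ∈ B
  linearIndependent : LinearIndependent ℚ (fun i => toQ (e i))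
  cone_eq : cone (Set.range e) = cone (B : Set (Fin n → ℤ))

/-- The submonoid `A = ⟨e₁, …, e_d⟩`. -/
def paramMonoid (e : Fin d → Fin n → ℤ) : AddSubmonoid (Fin n → ℤ) :=
  AddSubmonoid.closure (Set.range e)

/-- The set `B_A` of all `x ∈ B` with `x - a ∉ B` for all `a ∈ A \ {0}`. -/
def minimalSet (B : AddSubmonoid (Fin n → ℤ)) (e : Fin d → Fin n → ℤ) : Set (Fin n → ℤ) :=
  {x | x ∈ B ∧ ∀ a ∈ paramMonoid e, a ≠ 0 → x - a ∉ B}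

/-- The relation `x ∼ y`, that is, `x - y ∈ G(A)`, the group generated by `A`. -/
def Equivalent (e : Fin d → Fin n → ℤ) (x y : Fin n → ℤ) : Prop :=
  x - y ∈ AddSubgroup.closure (paramMonoid e : Set (Fin n → ℤ))

/-- The set `{Γ₁, …, Γ_f}` of the equivalence classes of `∼` on `B_A`. -/
def classes (B : AddSubmonoid (Fin n → ℤ)) (e : Fin d → Fin n → ℤ) :
    Set (Set (Fin n → ℤ)) :=
  {Γ | ∃ x ∈ minimalSet B e, Γ = {y | y ∈ minimalSet B e ∧ Equivalent e x y}}

open Classical in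
/-- The coordinates `λᵢˣ ∈ ℚ` with `x = ∑ λᵢˣ eᵢ`; unique for linearly independent `eᵢ`
(and `0` if `x` is not in the rational span of the `eᵢ`). -/
def coord (e : Fin d → Fin n → ℤ) (x : Fin n → ℤ) : Fin d → ℚ :=
  if h : ∃ c : Fin d → ℚ, toQ x = ∑ i, c i • toQ (e i) then h.choose else 0

open Classical in
/-- The minimum of a set of rational numbers (`0` if it has none). -/
def ratMin (S : Set ℚ) : ℚ :=
  if h : ∃ m, IsLeast S m then h.choose else 0

/-- The shift `h_Γ = ∑ᵢ min {λᵢˣ | x ∈ Γ} eᵢ` of a class `Γ`. -/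
def shift (e : Fin d → Fin n → ℤ) (Γ : Set (Fin n → ℤ)) : Fin n → ℚ :=
  ∑ i, ratMin ((fun x => coord e x i) '' Γ) • toQ (e i)

/-- The monomial ideal `I_Γ` of `T = K[A]` generated by the monomials `t^(x - h_Γ)`, `x ∈ Γ`.
(All the exponents `x - h_Γ` are in `A`, see `exists_sub_shift`.) -/
def monomialIdeal (K : Type*) [Field K] (e : Fin d → Fin n → ℤ) (Γ : Set (Fin n → ℤ)) :
    Ideal (AddMonoidAlgebra K (paramMonoid e)) :=
  Ideal.span {p | ∃ x ∈ Γ, ∃ a : paramMonoid e,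
    toQ (a : Fin n → ℤ) = toQ x - shift e Γ ∧ p = AddMonoidAlgebra.single a 1}

lemma ratMin_isLeast {S : Set ℚ} (h : ∃ m, IsLeast S m) : IsLeast S (ratMin S) := by
  unfold ratMin
  rw [dif_pos h]
  exact h.choose_spec

lemma coord_spec {e : Fin d → Fin n → ℤ} {x : Fin n → ℤ}
    (h : ∃ c : Fin d → ℚ, toQ x = ∑ i, c i • toQ (e i)) :
    toQ x = ∑ i, coord e x i • toQ (e i) := by
  unfold coord
  rw [dif_pos h]
  exact h.choose_spec

lemma toQ_add (x y : Fin n → ℤ) : toQ (x + y) = toQ x + toQ y := by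
  ext k; simp [toQ]

lemma toQ_sub (x y : Fin n → ℤ) : toQ (x - y) = toQ x - toQ y := by
  ext k; simp [toQ]

lemma toQ_zsmul (m : ℤ) (x : Fin n → ℤ) : toQ (m • x) = (m : ℚ) • toQ x := by
  ext k; simp [toQ]

lemma toQ_sum (f : Fin d → Fin n → ℤ) : toQ (∑ i, f i) = ∑ i, toQ (f i) := by
  ext k; simp [toQ]

lemma coord_eq {B : AddSubmonoid (Fin n → ℤ)} {e : Fin d → Fin n → ℤ} (hB : IsSimplicial B e)
    {x : Fin n → ℤ} {c : Fin d → ℚ} (h : toQ x = ∑ i, c i • toQ (e i)) : coord e x = c := by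
  have h1 := (coord_spec ⟨c, h⟩).symm.trans h
  have h2 := Fintype.linearIndependent_iff.1 hB.linearIndependent (fun i => coord e x i - c i)
    (by simp [sub_smul, Finset.sum_sub_distrib, h1])
  funext i
  linarith [h2 i]

/-- Elements of `B` have nonnegative rational coordinates. -/
lemma exists_coord {B : AddSubmonoid (Fin n → ℤ)} {e : Fin d → Fin n → ℤ}
    (hB : IsSimplicial B e) {x : Fin n → ℤ} (hx : x ∈ B) :
    ∃ c : Fin d → ℚ, (∀ i, 0 ≤ c i) ∧ toQ x = ∑ i, c i • toQ (e i) := by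
  have h : toQ x ∈ cone (Set.range e) := by
    rw [hB.cone_eq]
    exact Submodule.subset_span ⟨x, hx, rfl⟩
  rw [cone, ← Set.range_comp] at h
  obtain ⟨c, hc⟩ := (Submodule.mem_span_range_iff_exists_fun _).1 h
  exact ⟨fun i => (c i : ℚ), fun i => (c i).2, hc.symm⟩

lemma Equivalent.exists_int {e : Fin d → Fin n → ℤ} {x y : Fin n → ℤ} (h : Equivalent e x y) :
    ∃ m : Fin d → ℤ, x - y = ∑ i, m i • e i := by
  unfold Equivalent at h
  have h2 : AddSubgroup.closure (paramMonoid e : Set (Fin n → ℤ)) ≤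
      (Submodule.span ℤ (Set.range e)).toAddSubgroup := by
    rw [AddSubgroup.closure_le]
    intro z hz
    have : paramMonoid e ≤ (Submodule.span ℤ (Set.range e)).toAddSubmonoid := by
      unfold paramMonoid
      rw [AddSubmonoid.closure_le]
      exact Submodule.subset_span
    exact this hz
  obtain ⟨c, hc⟩ := (Submodule.mem_span_range_iff_exists_fun ℤ).1 (h2 h)
  exact ⟨c, hc.symm⟩

lemma coord_sub {B : AddSubmonoid (Fin n → ℤ)} {e : Fin d → Fin n → ℤ}
    (hB : IsSimplicial B e) {x y : Fin n → ℤ} (hy : y ∈ B) (h : Equivalent e x y) (i : Fin d) :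
    ∃ m : ℤ, coord e x i = coord e y i + m := by
  obtain ⟨m, hm⟩ := h.exists_int
  obtain ⟨c, -, hc⟩ := exists_coord hB hy
  refine ⟨m i, ?_⟩
  rw [coord_eq hB hc, coord_eq hB (c := fun i => c i + m i)]
  have : x = y + ∑ i, m i • e i := by rw [← hm]; abel
  rw [this, toQ_add, toQ_sum, hc]
  simp only [add_smul, Finset.sum_add_distrib, toQ_zsmul]

/-- The minima in the definition of `shift` exist. -/
lemma exists_isLeast {B : AddSubmonoid (Fin n → ℤ)} {e : Fin d → Fin n → ℤ}
    (hB : IsSimplicial B e) {Γ : Set (Fin n → ℤ)} (hΓ : Γ ∈ classes B e) (i : Fin d) :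
    ∃ m, IsLeast ((fun x => coord e x i) '' Γ) m := by
  obtain ⟨x, hx, rfl⟩ := hΓ
  have hlow : ∃ b : ℤ, ∀ z : ℤ, (∃ y, y ∈ minimalSet B e ∧ Equivalent e x y ∧
      coord e x i = coord e y i + (-z : ℤ)) → b ≤ z := by
    refine ⟨-⌈coord e x i⌉, ?_⟩
    rintro z ⟨y, hy, -, hz⟩
    obtain ⟨c, hc0, hc⟩ := exists_coord hB hy.1
    have h0 : 0 ≤ coord e y i := by rw [coord_eq hB hc]; exact hc0 i
    have h1 : ((-z : ℤ) : ℚ) ≤ ⌈coord e x i⌉ := by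
      have := Int.le_ceil (coord e x i)
      linarith
    have h2 : -z ≤ ⌈coord e x i⌉ := by exact_mod_cast h1
    omega
  obtain ⟨z, ⟨y, hy, hxy, hz⟩, hmin⟩ := Int.exists_least_of_bdd hlow
    ⟨0, x, hx, by simp [Equivalent], by simp⟩
  refine ⟨coord e y i, ⟨y, ⟨hy, hxy⟩, rfl⟩, ?_⟩
  rintro _ ⟨w, ⟨hw, hxw⟩, rfl⟩
  obtain ⟨m, hm⟩ := coord_sub hB hw.1 hxw i
  have h3 := hmin (-m) ⟨w, hw, hxw, by simpa using hm⟩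
  have h4 : (z : ℚ) ≤ ((-m : ℤ) : ℚ) := by exact_mod_cast h3
  push_cast at h4 hz
  show coord e y i ≤ coord e w i
  linarith

/-- All the exponents `x - h_Γ`, `x ∈ Γ`, are elements of `A`. -/
lemma exists_sub_shift {B : AddSubmonoid (Fin n → ℤ)} {e : Fin d → Fin n → ℤ}
    (hB : IsSimplicial B e) {Γ : Set (Fin n → ℤ)} (hΓ : Γ ∈ classes B e)
    {x : Fin n → ℤ} (hx : x ∈ Γ) :
    ∃ a : paramMonoid e, toQ (a : Fin n → ℤ) = toQ x - shift e Γ := by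
  have key : ∀ i, ∃ m : ℕ, coord e x i = ratMin ((fun x => coord e x i) '' Γ) + m := by
    intro i
    obtain ⟨⟨y, hy, hyi⟩, hle⟩ := ratMin_isLeast (exists_isLeast hB hΓ i)
    have hle' := hle (Set.mem_image_of_mem (fun x => coord e x i) hx)
    rw [← hyi] at hle' ⊢
    obtain ⟨w, hw, rfl⟩ := hΓ
    have hxy : Equivalent e x y := by
      have h1 := hy.2
      have h2 := hx.2
      unfold Equivalent at h1 h2 ⊢
      simpa using sub_mem h1 h2
    obtain ⟨m, hm⟩ := coord_sub hB hy.1.1 hxy i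
    simp only at hle' ⊢
    have h0 : (0 : ℚ) ≤ m := by linarith
    have h1 : 0 ≤ m := by exact_mod_cast h0
    lift m to ℕ using h1
    exact ⟨m, by simpa using hm⟩
  choose m hm using key
  have hxB : x ∈ B := by
    obtain ⟨w, hw, rfl⟩ := hΓ
    exact hx.1.1
  obtain ⟨c, -, hc⟩ := exists_coord hB hxB
  refine ⟨⟨∑ i, m i • e i, sum_mem fun i _ => nsmul_mem
    (AddSubmonoid.subset_closure (Set.mem_range_self i)) _⟩, ?_⟩
  rw [coord_spec ⟨c, hc⟩, shift, ← Finset.sum_sub_distrib]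
  simp only [hm, ← sub_smul, add_sub_cancel_left, toQ_sum]
  refine Finset.sum_congr rfl fun i _ => ?_
  ext k
  simp [toQ]

end AffineSemigroup

end

open CohenMacaulay AffineSemigroup

noncomputable section

/-! ### Combinatorics of `B_A`, and the equivalence of 2 and 3. -/

namespace AffineSemigroup

variable {n d : ℕ} {B : AddSubmonoid (Fin n → ℤ)} {e : Fin d → Fin n → ℤ}

/-! Each assertion is compared with one condition (*): equivalent elements of `B_A` are equal. Every
element of `B` lies in `y + A` for some `y ∈ B_A`, and no element of `B_A` lies in `y + A` for
another `y ∈ B`. Hence any family as in 2 contains `B_A`, and counting against the classes gives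
(*). In 4, an ideal `I_Γ` is the unit ideal iff some exponent vanishes, that is, iff `h_Γ ∈ Γ`; then
`Γ ⊆ h_Γ + A` is a singleton.

If (*) holds, `B` is the disjoint union of the translates `x + A`, `x ∈ B_A`, so `K[B]` is free over
`K[X₁, …, X_d]` (`free_of_forall_eq`). At a maximal ideal `m`, the minimal polynomials of the
residues of the `t^(e i)` give, by flatness, a regular sequence of length `d` in `m`; `m` is minimal
over it, so its height is at most `d`.

Conversely, let `x ≠ y` be equivalent in `B_A`. Then `t^q t^y = t^p t^x` for monomials in the `t^(e
i)` without common variable. A prime containing `t^p` and `t^q` contains two of the `t^(e i)`, so in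
the localization `R` at the monomial maximal ideal its quotient has dimension at most `d - 2`.
Unmixedness of `R/(t^p)` (`mem_span_of_mul_mem_span`) allows cancelling `t^q`, so `t^y ∈ (t^p)`,
against the minimality of `y`. -/

lemma toQ_injective : Function.Injective (toQ : (Fin n → ℤ) → Fin n → ℚ) := fun x y h => by
  funext k
  exact Int.cast_injective (congrFun h k)

lemma mem_paramMonoid_iff {a : Fin n → ℤ} :
    a ∈ paramMonoid e ↔ ∃ m : Fin d → ℕ, a = ∑ i, m i • e i := by
  rw [paramMonoid, AddSubmonoid.mem_closure_range_iff_of_fintype]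

lemma toQ_sum_nsmul (m : Fin d → ℕ) :
    toQ (∑ i, m i • e i) = ∑ i, (m i : ℚ) • toQ (e i) := by
  rw [toQ_sum]
  refine Finset.sum_congr rfl fun i _ => ?_
  ext k
  simp [toQ]

lemma Equivalent.refl (x : Fin n → ℤ) : Equivalent e x x := by simp [Equivalent]

lemma Equivalent.symm {x y : Fin n → ℤ} (h : Equivalent e x y) : Equivalent e y x := by
  have := neg_mem h
  rwa [neg_sub] at this

lemma Equivalent.trans {x y z : Fin n → ℤ} (h : Equivalent e x y) (h' : Equivalent e y z) :
    Equivalent e x z := by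
  have := add_mem h h'
  rwa [sub_add_sub_cancel] at this

lemma equivalent_add_sum (x : Fin n → ℤ) (m : Fin d → ℕ) :
    Equivalent e (x + ∑ i, m i • e i) x := by
  unfold Equivalent
  rw [add_sub_cancel_left]
  exact AddSubgroup.subset_closure (mem_paramMonoid_iff.2 ⟨m, rfl⟩)

namespace IsSimplicial

lemma toQ_eq (hB : IsSimplicial B e)
    {x : Fin n → ℤ} (hx : x ∈ B) : toQ x = ∑ i, coord e x i • toQ (e i) := by
  obtain ⟨c, -, hc⟩ := exists_coord hB hx
  exact coord_spec ⟨c, hc⟩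

lemma coord_nonneg (hB : IsSimplicial B e)
    {x : Fin n → ℤ} (hx : x ∈ B) (i : Fin d) : 0 ≤ coord e x i := by
  obtain ⟨c, h0, hc⟩ := exists_coord hB hx
  rw [coord_eq hB hc]
  exact h0 i

lemma coord_injOn (hB : IsSimplicial B e)
    {x y : Fin n → ℤ} (hx : x ∈ B) (hy : y ∈ B) (h : coord e x = coord e y) :
    x = y :=
  toQ_injective (by rw [hB.toQ_eq hx, hB.toQ_eq hy, h])

lemma coord_add (hB : IsSimplicial B e) {x y : Fin n → ℤ} (hx : x ∈ B) (hy : y ∈ B) :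
    coord e (x + y) = coord e x + coord e y :=
  coord_eq hB (by
    simp only [Pi.add_apply, add_smul, Finset.sum_add_distrib]
    rw [toQ_add, hB.toQ_eq hx, hB.toQ_eq hy])

lemma coord_sum_nsmul (hB : IsSimplicial B e)
    (m : Fin d → ℕ) : coord e (∑ i, m i • e i) = fun i => (m i : ℚ) :=
  coord_eq hB (toQ_sum_nsmul m)

lemma coord_zero (hB : IsSimplicial B e) : coord e 0 = 0 := by
  simpa [funext_iff] using hB.coord_sum_nsmul 0

lemma coord_e (hB : IsSimplicial B e) (i j : Fin d) : coord e (e i) j = if j = i then 1 else 0 := by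
  have := congrFun (hB.coord_sum_nsmul (Pi.single i 1)) j
  simpa [Finset.sum_pi_single', Pi.single_apply, ite_smul] using this

lemma sum_mem (hB : IsSimplicial B e) (m : Fin d → ℕ) : ∑ i, m i • e i ∈ B :=
  AddSubmonoid.sum_mem _ fun i _ => nsmul_mem (hB.mem i) _

lemma sum_nsmul_injective (hB : IsSimplicial B e)
    : Function.Injective fun m : Fin d → ℕ => ∑ i, m i • e i := by
  intro m m' h
  have h2 : coord e (∑ i, m i • e i) = coord e (∑ i, m' i • e i) := congrArg _ h
  rw [hB.coord_sum_nsmul, hB.coord_sum_nsmul] at h2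
  ext i
  exact_mod_cast congrFun h2 i

lemma sum_nsmul_ne_zero (hB : IsSimplicial B e)
    {m : Fin d → ℕ} (h : m ≠ 0) : ∑ i, m i • e i ≠ 0 := fun h0 =>
  h (hB.sum_nsmul_injective (by simpa using h0))

/-- Elements of `B_A` which differ by an element of `A` are equal. -/
lemma eq_zero_of_add_mem_minimalSet (hB : IsSimplicial B e)
    {y : Fin n → ℤ} (hy : y ∈ B) {m : Fin d → ℕ}
    (h : y + ∑ i, m i • e i ∈ minimalSet B e) : m = 0 := by
  by_contra hm
  refine h.2 _ (mem_paramMonoid_iff.2 ⟨m, rfl⟩) (hB.sum_nsmul_ne_zero hm) ?_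
  rwa [add_sub_cancel_right]

/-- Subtracting a nonzero element of `A` lowers the coordinate sum, nonnegative on `B`, by a
positive integer, so the floor of that sum is a measure for descent. -/
lemma exists_minimal_add (hB : IsSimplicial B e) {x : Fin n → ℤ} (hx : x ∈ B) :
    ∃ y ∈ minimalSet B e, ∃ m : Fin d → ℕ, x = y + ∑ i, m i • e i := by
  induction hN : ⌊∑ i, coord e x i⌋₊ using Nat.strong_induction_on generalizing x with
  | _ N ih =>
    by_cases hmin : x ∈ minimalSet B e
    · exact ⟨x, hmin, 0, by simp⟩
    · simp only [minimalSet, Set.mem_ofPred_eq, hx, true_and, not_forall, not_not] at hmin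
      obtain ⟨a, ha, ha0, hxa⟩ := hmin
      obtain ⟨m, rfl⟩ := mem_paramMonoid_iff.1 ha
      set z := x - ∑ i, m i • e i with hz
      have hxz : x = z + ∑ i, m i • e i := by rw [hz]; abel
      have hm : 1 ≤ ∑ i, m i := by
        rw [Nat.one_le_iff_ne_zero]
        intro h
        rw [Finset.sum_eq_zero_iff] at h
        exact ha0 (by simp [h])
      have hsum : ∑ i, coord e x i = ∑ i, coord e z i + (∑ i, m i : ℕ) := by
        rw [hxz, hB.coord_add hxa (hB.sum_mem m), hB.coord_sum_nsmul]
        simp [Finset.sum_add_distrib]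
      have h0 : 0 ≤ ∑ i, coord e z i := Finset.sum_nonneg fun i _ => hB.coord_nonneg hxa i
      have hlt : ⌊∑ i, coord e z i⌋₊ < N := by
        rw [← hN, hsum, Nat.floor_add_natCast h0]
        omega
      obtain ⟨y, hy, m', hm'⟩ := ih _ hlt hxa rfl
      refine ⟨y, hy, m' + m, ?_⟩
      rw [hxz, hm']
      simp [add_smul, Finset.sum_add_distrib, add_assoc]

/-- A positive multiple of every element of `B` lies in `A`. -/
lemma exists_nsmul_eq (hB : IsSimplicial B e) {x : Fin n → ℤ} (hx : x ∈ B) :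
    ∃ N : ℕ, 0 < N ∧ ∃ m : Fin d → ℕ, N • x = ∑ i, m i • e i := by
  -- The product of the denominators clears all coordinates at once.
  refine ⟨∏ i, (coord e x i).den, Finset.prod_pos fun i _ => (coord e x i).den_pos, ?_⟩
  have key : ∀ i, ∃ m : ℕ, ((∏ i, (coord e x i).den : ℕ) : ℚ) * coord e x i = m := by
    intro i
    obtain ⟨k, hk⟩ := Finset.dvd_prod_of_mem (fun i => (coord e x i).den) (Finset.mem_univ i)
    refine ⟨k * (coord e x i).num.toNat, ?_⟩
    have h1 : ((coord e x i).num.toNat : ℚ) = (coord e x i).num := by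
      have : ((coord e x i).num.toNat : ℤ) = (coord e x i).num :=
        Int.toNat_of_nonneg (Rat.num_nonneg.2 (hB.coord_nonneg hx i))
      exact_mod_cast this
    have h2 := Rat.mul_den_eq_num (coord e x i)
    rw [hk]
    push_cast
    rw [h1, ← h2]
    ring
  choose m hm using key
  refine ⟨m, toQ_injective ?_⟩
  rw [toQ_sum_nsmul]
  have : toQ ((∏ i, (coord e x i).den) • x) = ((∏ i, (coord e x i).den : ℕ) : ℚ) • toQ x := by
    ext k
    simp [toQ]
  rw [this, hB.toQ_eq hx, Finset.smul_sum]
  simp only [smul_smul, hm]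

/-- Each generator `s` of `B` has a multiple `N s • s` in `A`. Minimality forbids subtracting it
when `s ≠ 0`, which bounds the coefficient of `s`. -/
lemma finite_minimalSet (hB : IsSimplicial B e) : (minimalSet B e).Finite := by
  classical
  obtain ⟨S, hS⟩ := hB.fg
  have hSB : ∀ s ∈ S, s ∈ B := fun s hs => hS ▸ AddSubmonoid.subset_closure hs
  have key : ∀ s : S, ∃ N : ℕ, 0 < N ∧ N • (s : Fin n → ℤ) ∈ paramMonoid e := fun s => by
    obtain ⟨N, hN, m, hm⟩ := hB.exists_nsmul_eq (hSB s s.2)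
    exact ⟨N, hN, mem_paramMonoid_iff.2 ⟨m, hm⟩⟩
  choose N hN hNA using key
  refine ((Set.finite_Iic N).image fun c : S → ℕ => ∑ s, c s • (s : Fin n → ℤ)).subset ?_
  intro x hx
  -- The generator `0` is dropped: its coefficient is not bounded by minimality.
  have hxS : x ∈ AddSubmonoid.closure ((S \ {0} : Finset (Fin n → ℤ)) : Set (Fin n → ℤ)) := by
    rw [Finset.coe_sdiff, Finset.coe_singleton, AddSubmonoid.closure_sdiff_singleton_zero, hS]
    exact hx.1
  rw [AddSubmonoid.mem_closure_finset] at hxS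
  obtain ⟨c, hc, rfl⟩ := hxS
  have hc0 : c 0 = 0 := by
    by_contra h
    have := hc (Function.mem_support.2 h)
    simp at this
  have hsum : ∑ s ∈ S \ {0}, c s • s = ∑ s ∈ S, c s • s := by
    refine Finset.sum_subset Finset.sdiff_subset fun s hs hs' => ?_
    have : s = 0 := by simpa [hs] using hs'
    simp [this]
  rw [hsum] at hx ⊢
  refine ⟨fun s => c s, fun s => ?_, Finset.sum_coe_sort S fun s => c s • s⟩
  by_contra hlt
  replace hlt : N s < c s := not_le.1 hlt
  have hs0 : (s : Fin n → ℤ) ≠ 0 := fun h => by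
    rw [h, hc0] at hlt
    exact absurd hlt (by simp)
  refine hx.2 _ (hNA s) (smul_ne_zero (hN s).ne' hs0) ?_
  rw [← Finset.add_sum_erase S _ s.2]
  have : c s • (s : Fin n → ℤ) + ∑ x ∈ S.erase s, c x • x - N s • (s : Fin n → ℤ) =
      (c s - N s) • (s : Fin n → ℤ) + ∑ x ∈ S.erase s, c x • x := by
    obtain ⟨k, hk⟩ := Nat.exists_eq_add_of_lt hlt
    have : c s - N s = k + 1 := by omega
    rw [this, hk]
    simp only [add_smul, one_smul]
    abel
  rw [this]
  exact add_mem (nsmul_mem (hSB s s.2) _)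
    (AddSubmonoid.sum_mem _ fun t ht => nsmul_mem (hSB t (Finset.mem_of_mem_erase ht)) _)

end IsSimplicial

/-- The class of an element of `B_A`. -/
lemma mem_classes {x : Fin n → ℤ} (hx : x ∈ minimalSet B e) :
    {y | y ∈ minimalSet B e ∧ Equivalent e x y} ∈ classes B e := ⟨x, hx, rfl⟩

lemma forall_ncard_eq_one_iff :
    (∀ Γ ∈ classes B e, Γ.ncard = 1) ↔
      ∀ x ∈ minimalSet B e, ∀ y ∈ minimalSet B e, Equivalent e x y → x = y := by
  constructor
  · intro h x hx y hy hxy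
    obtain ⟨z, hz⟩ := Set.ncard_eq_one.1 (h _ (mem_classes hx))
    have h1 : x ∈ ({z} : Set (Fin n → ℤ)) := hz ▸ ⟨hx, .refl x⟩
    have h2 : y ∈ ({z} : Set (Fin n → ℤ)) := hz ▸ ⟨hy, hxy⟩
    exact h1.trans h2.symm
  · rintro h _ ⟨x, hx, rfl⟩
    refine Set.ncard_eq_one.2 ⟨x, Set.ext fun y => ⟨fun hy => (h x hx y hy.1 hy.2).symm, ?_⟩⟩
    rintro rfl
    exact ⟨hx, .refl _⟩

lemma exists_generators_iff (hB : IsSimplicial B e) :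
    (∃ γ : classes B e → (Fin n → ℤ), (∀ j, γ j ∈ B) ∧
        ∀ x ∈ B, ∃ (j : classes B e) (m : Fin d → ℕ), x = γ j + ∑ i, m i • e i) ↔
      ∀ x ∈ minimalSet B e, ∀ y ∈ minimalSet B e, Equivalent e x y → x = y := by
  constructor
  · rintro ⟨γ, hγB, hγ⟩
    have hfin : Finite (minimalSet B e) := hB.finite_minimalSet
    let cls : minimalSet B e → classes B e := fun x => ⟨_, mem_classes x.2⟩
    have hsurj : Function.Surjective cls := by
      rintro ⟨_, x, hx, rfl⟩
      exact ⟨⟨x, hx⟩, rfl⟩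
    have hfin' : Finite (classes B e) := Finite.of_surjective cls hsurj
    have key : ∀ x : minimalSet B e, ∃ j, γ j = x := fun x => by
      obtain ⟨j, m, hx⟩ := hγ x x.2.1
      have hm : m = 0 := hB.eq_zero_of_add_mem_minimalSet (hγB j) (hx ▸ x.2)
      exact ⟨j, by simp [hx, hm]⟩
    choose g hg using key
    have hginj : Function.Injective g := fun x y h => Subtype.ext (by rw [← hg x, ← hg y, h])
    -- The injection `g` of `B_A` into the finite set of classes makes the surjection `cls`
    -- bijective.
    have hbij := hsurj.bijective_of_nat_card_le (Nat.card_le_card_of_injective g hginj)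
    intro x hx y hy hxy
    have : cls ⟨x, hx⟩ = cls ⟨y, hy⟩ := by
      refine Subtype.ext (Set.ext fun z => ?_)
      exact ⟨fun hz => ⟨hz.1, hxy.symm.trans hz.2⟩, fun hz => ⟨hz.1, hxy.trans hz.2⟩⟩
    exact congrArg Subtype.val (hbij.1 this)
  · intro h
    have hne : ∀ j : classes B e, ∃ x ∈ minimalSet B e,
        j.1 = {y | y ∈ minimalSet B e ∧ Equivalent e x y} := fun j => j.2
    choose γ hγ hγj using hne
    refine ⟨γ, fun j => (hγ j).1, fun x hx => ?_⟩
    obtain ⟨y, hy, m, rfl⟩ := hB.exists_minimal_add hx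
    refine ⟨⟨_, mem_classes hy⟩, m, ?_⟩
    congr 1
    have := (Set.ext_iff.1 (hγj ⟨_, mem_classes hy⟩) y).1 ⟨hy, .refl y⟩
    exact (h _ (hγ _) _ hy this.2).symm

end AffineSemigroup

/-! ### Projections of a monoid algebra onto faces. -/

namespace AddMonoidAlgebra

variable (K : Type*) [Field K] {M : Type*} [AddCommMonoid M]

open Classical in
/-- The projection of `K[M]` onto the subalgebra `K[F]` of a face `F` of `M`, killing all
monomials with exponents outside of `F`. -/
def faceHom (F : AddSubmonoid M) (hF : ∀ a b, a + b ∈ F → a ∈ F ∧ b ∈ F) :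
    AddMonoidAlgebra K M →ₐ[K] AddMonoidAlgebra K M :=
  AddMonoidAlgebra.lift K (AddMonoidAlgebra K M) M
    { toFun := fun a => if a.toAdd ∈ F then AddMonoidAlgebra.single a.toAdd 1 else 0
      map_one' := by simp [F.zero_mem, AddMonoidAlgebra.one_def]
      map_mul' := fun a b => by
        by_cases h : a.toAdd + b.toAdd ∈ F
        · obtain ⟨ha, hb⟩ := hF _ _ h
          simp [h, ha, hb, AddMonoidAlgebra.single_mul_single]
        · have : ¬(a.toAdd ∈ F ∧ b.toAdd ∈ F) := fun h' => h (F.add_mem h'.1 h'.2)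
          rw [toAdd_mul, if_neg h]
          by_cases ha : a.toAdd ∈ F
          · rw [if_neg fun hb => this ⟨ha, hb⟩, mul_zero]
          · rw [if_neg ha, zero_mul] }

variable {K} {F : AddSubmonoid M} {hF : ∀ a b, a + b ∈ F → a ∈ F ∧ b ∈ F}

open Classical in
lemma faceHom_single (a : M) (r : K) :
    faceHom K F hF (single a r) = if a ∈ F then single a r else 0 := by
  simp [faceHom, AddMonoidAlgebra.lift_single]

open Classical in
lemma coeff_faceHom (p : AddMonoidAlgebra K M) (a : M) :
    (faceHom K F hF p).coeff a = if a ∈ F then p.coeff a else 0 := by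
  induction p using AddMonoidAlgebra.induction_linear with
  | zero => simp
  | add p q hp hq => simp [hp, hq]; split_ifs <;> simp
  | single b r =>
    rw [faceHom_single]
    by_cases hab : b = a
    · subst hab; split_ifs <;> simp
    · split_ifs <;> simp [hab]

lemma mem_ker_faceHom {p : AddMonoidAlgebra K M} :
    p ∈ RingHom.ker (faceHom K F hF) ↔ ∀ a ∈ F, p.coeff a = 0 := by
  classical
  rw [RingHom.mem_ker, ← AddMonoidAlgebra.coeff_inj, Finsupp.ext_iff]
  simp [coeff_faceHom]

lemma single_mem_ker_faceHom {a : M} : single a (1 : K) ∈ RingHom.ker (faceHom K F hF) ↔ a ∉ F := by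
  classical
  rw [RingHom.mem_ker, faceHom_single]
  split_ifs with h <;> simp [h]

lemma ker_faceHom_ne_top : RingHom.ker (faceHom K F hF) ≠ ⊤ := RingHom.ker_ne_top _

/-- The kernel of the projection to the trivial face is maximal. -/
lemma isMaximal_ker_faceHom (h : F = ⊥) :
    (RingHom.ker (faceHom K F hF)).IsMaximal := by
  subst h
  rw [Ideal.isMaximal_iff]
  refine ⟨fun h => ker_faceHom_ne_top ((Ideal.eq_top_iff_one _).2 h), fun J p hJ hp hpJ => ?_⟩
  rw [mem_ker_faceHom] at hp
  have hp0 : p.coeff 0 ≠ 0 := by simpa using hp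
  -- Modulo the kernel, `p` is its constant coefficient, a unit.
  have h1 : p - algebraMap K _ (p.coeff 0) ∈ J := hJ (mem_ker_faceHom.2 (by simp))
  have h2 : algebraMap K (AddMonoidAlgebra K M) (p.coeff 0) ∈ J := by
    simpa using J.sub_mem hpJ h1
  have h3 := J.mul_mem_left (algebraMap K _ (p.coeff 0)⁻¹) h2
  rwa [← map_mul, inv_mul_cancel₀ hp0, map_one] at h3

end AddMonoidAlgebra

/-! ### The equivalence of 3 and 4. -/

namespace AffineSemigroup

variable {n d : ℕ} {B : AddSubmonoid (Fin n → ℤ)} {e : Fin d → Fin n → ℤ}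

lemma IsSimplicial.eq_zero_of_add_eq_zero (hB : IsSimplicial B e) {x y : Fin n → ℤ} (hx : x ∈ B)
    (hy : y ∈ B) (h : x + y = 0) : x = 0 ∧ y = 0 := by
  have key := hB.coord_add hx hy
  rw [h, hB.coord_zero] at key
  have hi : ∀ i, coord e x i = 0 ∧ coord e y i = 0 := fun i => by
    have h1 := hB.coord_nonneg hx i
    have h2 := hB.coord_nonneg hy i
    have h3 := congrFun key i
    simp only [Pi.zero_apply, Pi.add_apply] at h3
    constructor <;> linarith
  constructor
  · exact hB.coord_injOn hx B.zero_mem (by rw [hB.coord_zero]; exact funext fun i => (hi i).1)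
  · exact hB.coord_injOn hy B.zero_mem (by rw [hB.coord_zero]; exact funext fun i => (hi i).2)

lemma IsSimplicial.paramMonoid_le (hB : IsSimplicial B e) : paramMonoid e ≤ B := by
  intro x hx
  obtain ⟨m, rfl⟩ := mem_paramMonoid_iff.1 hx
  exact hB.sum_mem m

lemma forall_monomialIdeal_eq_top_iff (K : Type*) [Field K] (hB : IsSimplicial B e) :
    (∀ Γ ∈ classes B e, monomialIdeal K e Γ = ⊤) ↔
      ∀ x ∈ minimalSet B e, ∀ y ∈ minimalSet B e, Equivalent e x y → x = y := by
  constructor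
  · intro h x hx
    set Γ := {y | y ∈ minimalSet B e ∧ Equivalent e x y} with hΓ
    have hΓc : Γ ∈ classes B e := mem_classes hx
    -- If no exponent vanished, all generators would lie in the kernel of the projection to the
    -- trivial face, a proper ideal.
    obtain ⟨z, hz, hz0⟩ : ∃ z ∈ Γ, toQ z = shift e Γ := by
      by_contra! hne
      have hF : ∀ a b : paramMonoid e, a + b ∈ (⊥ : AddSubmonoid (paramMonoid e)) →
          a ∈ (⊥ : AddSubmonoid (paramMonoid e)) ∧ b ∈ (⊥ : AddSubmonoid (paramMonoid e)) := by
        intro a b hab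
        have := hB.eq_zero_of_add_eq_zero (hB.paramMonoid_le a.2) (hB.paramMonoid_le b.2)
          (congrArg Subtype.val (AddSubmonoid.mem_bot.1 hab))
        exact ⟨Subtype.ext this.1, Subtype.ext this.2⟩
      have hle : monomialIdeal K e Γ ≤ RingHom.ker (AddMonoidAlgebra.faceHom K ⊥ hF) := by
        rw [monomialIdeal, Ideal.span_le]
        rintro _ ⟨y, hy, a, ha, rfl⟩
        refine AddMonoidAlgebra.single_mem_ker_faceHom.2 fun ha0 => hne y hy ?_
        rw [AddSubmonoid.mem_bot.1 ha0] at ha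
        have h0 : toQ ((0 : paramMonoid e) : Fin n → ℤ) = 0 := by
          ext k
          simp [toQ]
        rw [h0] at ha
        exact (sub_eq_zero.1 ha.symm)
      rw [h Γ hΓc] at hle
      exact AddMonoidAlgebra.ker_faceHom_ne_top (top_le_iff.1 hle)
    have key : ∀ y ∈ Γ, y = z := by
      intro y hy
      obtain ⟨a, ha⟩ := exists_sub_shift hB hΓc hy
      obtain ⟨m, hm⟩ := mem_paramMonoid_iff.1 a.2
      rw [← hz0, ← toQ_sub] at ha
      have hyz : y = z + ∑ i, m i • e i := by rw [← hm, toQ_injective ha]; abel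
      have hm0 : m = 0 := hB.eq_zero_of_add_mem_minimalSet hz.1.1 (hyz ▸ hy.1)
      rw [hyz, hm0]
      simp
    intro y hy hxy
    rw [key x ⟨hx, .refl x⟩, key y ⟨hy, hxy⟩]
  · rintro h Γ hΓ
    obtain ⟨x, hx⟩ := Set.ncard_eq_one.1 (forall_ncard_eq_one_iff.2 h Γ hΓ)
    have hxB : x ∈ B := by
      obtain ⟨y, hy, rfl⟩ := hΓ
      exact ((Set.ext_iff.1 hx x).2 rfl).1.1
    rw [Ideal.eq_top_iff_one]
    refine Ideal.subset_span ⟨x, hx ▸ rfl, 0, ?_, AddMonoidAlgebra.one_def⟩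
    have hmin : ∀ i, ratMin ((fun x => coord e x i) '' Γ) = coord e x i := fun i => by
      obtain ⟨⟨y, hy, hyi⟩, -⟩ := ratMin_isLeast (exists_isLeast hB hΓ i)
      rw [hx] at hy
      rw [← hyi, hy]
    rw [shift]
    simp only [hmin]
    rw [← hB.toQ_eq hxB, sub_self]
    ext k
    simp [toQ]

end AffineSemigroup

/-! ### Depth, associated primes and unmixedness over Noetherian local rings. -/

namespace CohenMacaulay

universe u

open Pointwise CategoryTheory Abelian in
/-- Dividing out a regular element of a local ring lowers the depth of a finite module by at most
one. -/
lemma exists_isRegular_quotSMulTop {R : Type u} [CommRing R] [IsNoetherianRing R] [IsLocalRing R]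
    {M : Type u} [AddCommGroup M] [Module R M] [Module.Finite R M] [Nontrivial M] {a : R}
    (ha : a ∈ IsLocalRing.maximalIdeal R) (reg : IsSMulRegular M a) {rs : List R} {k : ℕ}
    (hlen : rs.length = k + 1) (mem : ∀ r ∈ rs, r ∈ IsLocalRing.maximalIdeal R)
    (hrs : IsRegular M rs) :
    ∃ rs' : List R, rs'.length = k ∧ (∀ r ∈ rs', r ∈ IsLocalRing.maximalIdeal R) ∧
      IsRegular (QuotSMulTop a M) rs' := by
  have lt_top (N : Type u) [AddCommGroup N] [Module R N] [Module.Finite R N] [Nontrivial N] :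
      IsLocalRing.maximalIdeal R • (⊤ : Submodule R N) < ⊤ := by
    refine lt_top_iff_ne_top.2 fun h => top_ne_bot (α := Submodule R N) ?_
    exact Submodule.eq_bot_of_le_smul_of_le_jacobson_bot _ _ Module.Finite.fg_top h.ge
      (IsLocalRing.maximalIdeal_le_jacobson _)
  have : Nontrivial (QuotSMulTop a M) := nontrivial_quotSMulTop_of_mem_maximalIdeal M ha
  -- Rees: regular sequences of a given length correspond to vanishing of Ext in the degrees below
  -- it. The long exact sequence of multiplication by `a` places Ext of `M/aM` in degree `i` between
  -- those of `M` in degrees `i` and `i + 1`.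
  have hrees := (ModuleCat.exists_isRegular_tfae (IsLocalRing.maximalIdeal R) (k + 1)
    (ModuleCat.of R M) (lt_top M)).out 1 3
  have hM := hrees.2 ⟨rs, hlen, mem, hrs⟩
  refine ((ModuleCat.exists_isRegular_tfae (IsLocalRing.maximalIdeal R) k
    (ModuleCat.of R (QuotSMulTop a M)) (lt_top _)).out 1 3).1 fun i hi => ?_
  have zero1 := AddCommGrpCat.isZero_of_iff_subsingleton.mpr (hM i (by omega))
  have zero2 := AddCommGrpCat.isZero_of_iff_subsingleton.mpr (hM (i + 1) (by omega))
  exact AddCommGrpCat.subsingleton_of_isZero <|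
    ShortComplex.Exact.isZero_of_both_zeros
      ((Ext.covariant_sequence_exact₃' _
        (IsSMulRegular.smulShortComplex_shortExact (M := ModuleCat.of R M) reg)) i (i + 1) rfl)
      (zero1.eq_zero_of_src _) (zero2.eq_zero_of_tgt _)

open Pointwise in
/-- The length of a regular sequence on a finite module `M` over a Noetherian local ring is at most
the dimension of `R ⧸ P` for every associated prime `P` of `M`. -/
lemma length_le_ringKrullDim_quotient {R M : Type*} [CommRing R] [IsNoetherianRing R]
    [IsLocalRing R] [AddCommGroup M] [Module R M] [Module.Finite R M] {P : Ideal R}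
    (hP : IsAssociatedPrime P M) {rs : List R} (mem : ∀ r ∈ rs, r ∈ IsLocalRing.maximalIdeal R)
    (hrs : IsWeaklyRegular M rs) : (rs.length : WithBot ℕ∞) ≤ ringKrullDim (R ⧸ P) := by
  induction rs generalizing M P with
  | nil =>
    have := Ideal.Quotient.nontrivial_iff.2 hP.isPrime.ne_top
    simpa using ringKrullDim_nonneg_of_nontrivial
  | cons r rs ih =>
    obtain ⟨hr, hrs⟩ := (isWeaklyRegular_cons_iff M r rs).1 hrs
    have hPp := hP.isPrime
    obtain ⟨-, x, hx⟩ := isAssociatedPrime_iff.1 hP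
    have hmem : ∀ p, p ∈ P ↔ p • x = 0 := fun p => by
      rw [hx, Submodule.mem_colon_singleton, Submodule.mem_bot]
    have hx0 : x ≠ 0 := fun h => hPp.ne_top ((Ideal.eq_top_iff_one _).2 ((hmem 1).2 (by simp [h])))
    -- Let `N` be the elements killed by `P`. As `r` is regular, `N ⊆ rM` would give `N = rN`, so `N
    -- = 0` by Nakayama, although `x ∈ N`.
    obtain ⟨y, hy, hyr⟩ : ∃ y ∈ Submodule.torsionBySet R M P, y ∉ r • (⊤ : Submodule R M) := by
      by_contra! hle
      refine hx0 ((Submodule.mem_bot R).1 ?_)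
      rw [← Submodule.eq_bot_of_le_smul_of_le_jacobson_bot (Ideal.span {r})
        (Submodule.torsionBySet R M P) (IsNoetherian.noetherian _) ?_ ?_]
      · exact (Submodule.mem_torsionBySet_iff _ _).2 fun p => (hmem p).1 p.2
      · intro y hy
        obtain ⟨z, -, rfl⟩ := (Submodule.mem_smul_pointwise_iff_exists _ _ _).1 (hle y hy)
        refine Submodule.smul_mem_smul (Ideal.mem_span_singleton_self r) ?_
        rw [Submodule.mem_torsionBySet_iff] at hy ⊢
        intro p
        refine hr.right_eq_zero_of_smul ?_
        rw [smul_comm]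
        exact hy p
      · rw [Ideal.span_singleton_le_iff_mem]
        exact IsLocalRing.maximalIdeal_le_jacobson _ (mem r (by simp))
    let y' : QuotSMulTop r M := Submodule.Quotient.mk y
    have hy'0 : y' ≠ 0 := fun h => hyr ((Submodule.Quotient.mk_eq_zero _).1 h)
    -- The class of `y` is killed by `P` and `r`, so `Q` contains both; as `r ∉ P`, the dimension
    -- drops from `R/P` to `R/Q`.
    obtain ⟨Q, hQ, hle⟩ := exists_le_isAssociatedPrime_of_isNoetherianRing R y' hy'0
    have hPQ : P ≤ Q := fun p hp => hle <| by
      rw [Submodule.mem_colon_singleton, Submodule.mem_bot]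
      rw [Submodule.mem_torsionBySet_iff] at hy
      change Submodule.Quotient.mk (p • y) = _
      rw [hy ⟨p, hp⟩, Submodule.Quotient.mk_zero]
    have hrQ : r ∈ Q := hle <| by
      rw [Submodule.mem_colon_singleton, Submodule.mem_bot]
      exact (Submodule.Quotient.mk_eq_zero _).2
        (Submodule.smul_mem_pointwise_smul y r ⊤ Submodule.mem_top)
    have hrP : r ∉ P := fun h => hx0 (hr.right_eq_zero_of_smul ((hmem r).1 h))
    have hdim := ringKrullDim_succ_le_of_surjective (Ideal.Quotient.factor hPQ)
      (Ideal.Quotient.factor_surjective hPQ) (r := Ideal.Quotient.mk P r)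
      (mem_nonZeroDivisors_of_ne_zero (by rwa [ne_eq, Ideal.Quotient.eq_zero_iff_mem]))
      (by simpa [Ideal.Quotient.eq_zero_iff_mem] using hrQ)
    have := ih hQ (fun s hs => mem s (by simp [hs])) hrs
    rw [List.length_cons, Nat.cast_add, Nat.cast_one]
    exact (add_le_add_left this 1).trans hdim

open Pointwise in
/-- Unmixedness: if a Noetherian local ring `R` has a regular sequence of length `k + 1`, then
`b` is regular modulo the regular element `a` as soon as all quotients of `R` by primes
containing `a` and `b` have dimension less than `k`. -/
lemma mem_span_of_mul_mem_span {R : Type*} [CommRing R] [IsNoetherianRing R] [IsLocalRing R]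
    {a b : R} (ha : a ∈ IsLocalRing.maximalIdeal R) (hreg : IsSMulRegular R a) {rs : List R}
    {k : ℕ} (hlen : rs.length = k + 1) (mem : ∀ r ∈ rs, r ∈ IsLocalRing.maximalIdeal R)
    (hrs : IsRegular R rs)
    (hdim : ∀ P : Ideal R, P.IsPrime → a ∈ P → b ∈ P → ringKrullDim (R ⧸ P) < k) {x : R}
    (hx : b * x ∈ Ideal.span {a}) : x ∈ Ideal.span {a} := by
  obtain ⟨rs', hlen', mem', hrs'⟩ := exists_isRegular_quotSMulTop ha hreg hlen mem hrs
  have htop : a • (⊤ : Ideal R) = Ideal.span {a} := by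
    rw [← Submodule.ideal_span_singleton_smul, smul_eq_mul, Ideal.mul_top]
  by_contra hxa
  let x' : QuotSMulTop a R := Submodule.Quotient.mk x
  have hx'0 : x' ≠ 0 := fun h => hxa (htop ▸ (Submodule.Quotient.mk_eq_zero _).1 h)
  -- An associated prime of `R/(a)` over the annihilator of `x` contains `a` and `b`, but `R/(a)`
  -- has a regular sequence of length `k`.
  obtain ⟨Q, hQ, hle⟩ := exists_le_isAssociatedPrime_of_isNoetherianRing R x' hx'0
  have hcolon : ∀ c : R, c * x ∈ Ideal.span {a} → c ∈ Q := fun c hc => hle <| by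
    rw [Submodule.mem_colon_singleton, Submodule.mem_bot]
    exact (Submodule.Quotient.mk_eq_zero _).2 (htop ▸ hc)
  refine (length_le_ringKrullDim_quotient hQ mem' hrs'.1).not_gt ?_
  rw [hlen']
  exact hdim Q hQ.isPrime
    (hcolon a (Ideal.mul_mem_right _ _ (Ideal.mem_span_singleton_self a))) (hcolon b hx)

end CohenMacaulay

/-! ### Regular sequences of monic polynomials, and a dimension bound. -/

open Polynomial Pointwise in
/-- If `rs` is weakly regular on `S` and `g` is a monic polynomial over `S`, then `g, rs` is weakly
regular on `S[X]`. -/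
lemma Polynomial.isWeaklyRegular_cons_map_C {S : Type*} [CommRing S] {g : S[X]} (hg : g.Monic)
    {rs : List S} (hrs : IsWeaklyRegular S rs) : IsWeaklyRegular S[X] (g :: rs.map C) := by
  rw [isWeaklyRegular_cons_iff]
  refine ⟨fun p q h => hg.isRegular.left h, ?_⟩
  -- The quotient by a monic polynomial is free, hence flat, over `S`, so `rs` stays weakly regular
  -- on it.
  have : Module.Free S (S[X] ⧸ Ideal.span {g}) := hg.free_quotient
  have h1 := (isWeaklyRegular_map_algebraMap_iff (S[X] ⧸ Ideal.span {g}) (S[X] ⧸ Ideal.span {g})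
    rs).1 (hrs.of_flat (S := S[X] ⧸ Ideal.span {g}))
  have h2 := (isWeaklyRegular_map_algebraMap_iff S[X] (S[X] ⧸ Ideal.span {g}) rs).2 h1
  refine (LinearEquiv.isWeaklyRegular_congr (Submodule.quotEquivOfEq _ _ ?_) _).2 h2
  rw [← Submodule.ideal_span_singleton_smul, smul_eq_mul, Ideal.mul_top]

/-- Monic polynomials in separate variables form a weakly regular sequence. -/
lemma MvPolynomial.isWeaklyRegular_ofFn_aeval_X {K : Type*} [CommRing K] {d : ℕ}
    (f : Fin d → Polynomial K) (hf : ∀ i, (f i).Monic) :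
    IsWeaklyRegular (MvPolynomial (Fin d) K)
      (List.ofFn fun i => Polynomial.aeval (X i : MvPolynomial (Fin d) K) (f i)) := by
  induction d with
  | zero => simp
  | succ d ih =>
    -- The variable `X 0` is taken as outermost: `f 0` stays monic and the other polynomials become
    -- constants.
    have key := Polynomial.isWeaklyRegular_cons_map_C
      ((hf 0).map (algebraMap K (MvPolynomial (Fin d) K)))
      (ih (fun i => f i.succ) fun i => hf i.succ)
    refine ((finSuccEquiv K d).toAddEquiv.isWeaklyRegular_congr ?_).2 key
    rw [List.ofFn_succ, List.map_ofFn, List.forall₂_cons, List.forall₂_iff_get]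
    refine ⟨fun p => ?_, by simp, fun i hi hi' p => ?_⟩
    · rw [smul_eq_mul, smul_eq_mul]
      refine (map_mul (finSuccEquiv K d) _ _).trans (congrArg (· * _) ?_)
      rw [← Polynomial.aeval_algHom_apply, finSuccEquiv_X_zero, Polynomial.aeval_def]
      rfl
    · simp only [List.get_eq_getElem, List.getElem_ofFn, smul_eq_mul, Function.comp_apply]
      refine (map_mul (finSuccEquiv K d) _ _).trans (congrArg (· * _) ?_)
      rw [← Polynomial.aeval_algHom_apply, finSuccEquiv_X_succ]
      exact Polynomial.aeval_algHom_apply (Polynomial.CAlgHom (R := K)) _ _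

/-- A local ring `R ⧸ P` whose maximal ideal is the radical of an ideal generated by the images
of finitely many elements has dimension at most their number. -/
lemma ringKrullDim_quotient_le_card {R : Type*} [CommRing R] [IsNoetherianRing R] [IsLocalRing R]
    (P : Ideal R) [P.IsPrime] (s : Finset R) (hs : ∀ r ∈ s, r ∈ IsLocalRing.maximalIdeal R)
    (h : ∀ Q : Ideal R, Q.IsPrime → P ≤ Q → (∀ r ∈ s, r ∈ Q) → IsLocalRing.maximalIdeal R ≤ Q) :
    ringKrullDim (R ⧸ P) ≤ s.card := by
  classical
  have : IsLocalRing (R ⧸ P) :=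
    .of_surjective' (Ideal.Quotient.mk P) Ideal.Quotient.mk_surjective
  have hmk : ∀ r ∈ IsLocalRing.maximalIdeal R,
      Ideal.Quotient.mk P r ∈ IsLocalRing.maximalIdeal (R ⧸ P) := fun r hr => by
    rw [IsLocalRing.mem_maximalIdeal, mem_nonunits_iff] at hr ⊢
    have : IsLocalHom (Ideal.Quotient.mk P) := .of_surjective _ Ideal.Quotient.mk_surjective
    rwa [isUnit_map_iff]
  rw [← IsLocalRing.maximalIdeal_height_eq_ringKrullDim]
  have key : (IsLocalRing.maximalIdeal (R ⧸ P)).height ≤ (s.image (Ideal.Quotient.mk P)).card := by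
    refine Ideal.height_le_card_of_mem_minimalPrimes_span_finset
      ⟨⟨inferInstance, Ideal.span_le.2 ?_⟩, ?_⟩
    · intro r hr
      obtain ⟨r', hr', rfl⟩ := Finset.mem_image.1 (Finset.mem_coe.1 hr)
      exact hmk r' (hs r' hr')
    · rintro Q ⟨hQ, hsQ⟩ - z hz
      obtain ⟨w, rfl⟩ := Ideal.Quotient.mk_surjective z
      have hw : w ∈ IsLocalRing.maximalIdeal R := by
        rw [IsLocalRing.mem_maximalIdeal, mem_nonunits_iff] at hz ⊢
        exact fun hu => hz (hu.map _)
      refine h (Q.comap (Ideal.Quotient.mk P)) inferInstance (fun p hp => ?_) (fun r hr => ?_) hw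
      · rw [Ideal.mem_comap, Ideal.Quotient.eq_zero_iff_mem.2 hp]
        exact Q.zero_mem
      · exact hsQ (Ideal.subset_span (Finset.mem_image_of_mem _ hr))
  exact WithBot.coe_le_coe.2 (key.trans (Nat.cast_le.2 Finset.card_image_le))

/-- In a Cohen-Macaulay local ring there are regular sequences of length equal to the dimension. -/
lemma CohenMacaulay.IsCohenMacaulayLocalRing.exists_isRegular {R : Type*} [CommRing R]
    [IsLocalRing R] (h : IsCohenMacaulayLocalRing R) {k : ℕ}
    (hk : (k : WithBot ℕ∞) < ringKrullDim R) :
    ∃ rs : List R, k < rs.length ∧ (∀ r ∈ rs, r ∈ IsLocalRing.maximalIdeal R) ∧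
      IsRegular R rs := by
  rw [← h.2] at hk
  have hk' : (k : ℕ∞) < depth R := by exact_mod_cast hk
  obtain ⟨rs, hrs⟩ := lt_iSup_iff.1 hk'
  obtain ⟨⟨hmem, hreg⟩, hlt⟩ := lt_iSup_iff.1 hrs
  exact ⟨rs, by exact_mod_cast hlt, hmem, hreg⟩

/-! ### Face primes of `K[B]`, and 1 implies 3. -/

namespace AffineSemigroup

variable {n d : ℕ} {B : AddSubmonoid (Fin n → ℤ)} {e : Fin d → Fin n → ℤ}

/-- Unique sums, inherited from `ℤⁿ`, exclude zero divisors in `K[B]`. -/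
instance instUniqueSums : UniqueSums B :=
  .of_injective_addHom (B.subtype : B →ₙ+ (Fin n → ℤ)) Subtype.val_injective inferInstance

instance instIsDomain (K : Type*) [Field K] : IsDomain (AddMonoidAlgebra K B) :=
  NoZeroDivisors.to_isDomain _

namespace IsSimplicial

variable (K : Type*) [Field K]

lemma isNoetherianRing (hB : IsSimplicial B e) : IsNoetherianRing (AddMonoidAlgebra K B) := by
  have : AddMonoid.FG B := (AddMonoid.fg_iff_addSubmonoid_fg B).2 hB.fg
  have := AddMonoidAlgebra.finiteType_of_fg K B
  exact Algebra.FiniteType.isNoetherianRing K _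

/-- The monomial `t^(e i)` of `K[B]`. -/
def var (hB : IsSimplicial B e)
    (i : Fin d) : AddMonoidAlgebra K B := AddMonoidAlgebra.single ⟨e i, hB.mem i⟩ 1

lemma prod_var_pow (hB : IsSimplicial B e) (m : Fin d → ℕ) :
    ∏ i, hB.var K i ^ m i = AddMonoidAlgebra.single ⟨∑ i, m i • e i, hB.sum_mem m⟩ 1 := by
  simp only [var, AddMonoidAlgebra.single_pow, one_pow, AddMonoidAlgebra.prod_single,
    Finset.prod_const_one]
  congr 1
  ext1
  simp

/-- A positive power of each monomial of `K[B]` is a monomial in the `t^(e i)`. -/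
lemma exists_single_pow_eq (hB : IsSimplicial B e) (b : B) : ∃ N : ℕ, 0 < N ∧ ∃ m : Fin d → ℕ,
    (AddMonoidAlgebra.single b (1 : K)) ^ N = ∏ i, hB.var K i ^ m i ∧ N • (b : Fin n → ℤ) =
      ∑ i, m i • e i := by
  obtain ⟨N, hN, m, hm⟩ := hB.exists_nsmul_eq b.2
  refine ⟨N, hN, m, ?_, hm⟩
  rw [hB.prod_var_pow K, AddMonoidAlgebra.single_pow, one_pow]
  congr 1
  exact Subtype.ext hm

/-- The face of `B` on which the first `k` coordinates vanish. -/
def face (hB : IsSimplicial B e) (k : ℕ) : AddSubmonoid B where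
  carrier := {b | ∀ i : Fin d, i < k → coord e b i = 0}
  zero_mem' := fun i _ => by simp [hB.coord_zero]
  add_mem' := fun {a b} ha hb i hi => by
    simp [hB.coord_add a.2 b.2, ha i hi, hb i hi]

lemma face_isFace (hB : IsSimplicial B e)
    (k : ℕ) (a b : B) (h : a + b ∈ hB.face k) : a ∈ hB.face k ∧ b ∈ hB.face k := by
  have key : ∀ i : Fin d, i < k → coord e a i = 0 ∧ coord e b i = 0 := fun i hi => by
    have h1 := hB.coord_nonneg a.2 i
    have h2 := hB.coord_nonneg b.2 i
    have h3 := h i hi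
    rw [AddSubmonoid.coe_add, hB.coord_add a.2 b.2, Pi.add_apply] at h3
    constructor <;> linarith
  exact ⟨fun i hi => (key i hi).1, fun i hi => (key i hi).2⟩

lemma face_eq_bot (hB : IsSimplicial B e) : hB.face d = ⊥ := by
  rw [eq_bot_iff]
  refine fun b hb => AddSubmonoid.mem_bot.2 (Subtype.ext ?_)
  refine hB.coord_injOn b.2 B.zero_mem ?_
  rw [AddSubmonoid.coe_zero, hB.coord_zero]
  exact funext fun i => hb i i.2

/-- The prime ideal of `K[B]` spanned by the monomials with exponents outside the `k`-th face. -/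
def facePrime (hB : IsSimplicial B e) (k : ℕ) : Ideal (AddMonoidAlgebra K B) :=
  RingHom.ker (AddMonoidAlgebra.faceHom K (hB.face k) (hB.face_isFace k))

instance instIsPrimeFacePrime (hB : IsSimplicial B e)
    (k : ℕ) : (hB.facePrime K k).IsPrime := RingHom.ker_isPrime _

instance instIsMaximalFacePrime (hB : IsSimplicial B e) : (hB.facePrime K d).IsMaximal :=
  AddMonoidAlgebra.isMaximal_ker_faceHom hB.face_eq_bot

/-- The monomial `t^(e k)` separates the two: `e k` has coordinate `1` at `k` and `0` before it. -/
lemma facePrime_lt_succ (hB : IsSimplicial B e)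
    {k : ℕ} (hk : k < d) : hB.facePrime K k < hB.facePrime K (k + 1) := by
  refine lt_of_le_not_ge (fun p hp => ?_) fun hle => ?_
  · rw [facePrime, AddMonoidAlgebra.mem_ker_faceHom] at hp ⊢
    exact fun a ha => hp a fun i hi => ha i (by omega)
  · have h1 : hB.var K ⟨k, hk⟩ ∈ hB.facePrime K (k + 1) :=
      AddMonoidAlgebra.single_mem_ker_faceHom.2 fun h => by
        simpa [hB.coord_e] using h ⟨k, hk⟩ (by simp)
    refine AddMonoidAlgebra.single_mem_ker_faceHom.1 (hle h1) fun i hi => ?_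
    rw [hB.coord_e, if_neg]
    rintro rfl
    simp at hi

lemma le_height_facePrime (hB : IsSimplicial B e)
    {k : ℕ} (hk : k ≤ d) : (k : ℕ∞) ≤ (hB.facePrime K k).height := by
  induction k with
  | zero => simp
  | succ k ih =>
    rw [Nat.cast_add, Nat.cast_one]
    exact (add_le_add_left (ih (by omega)) 1).trans
      (Ideal.height_add_one_le_of_lt_of_isPrime (hB.facePrime_lt_succ K hk))

lemma single_mem_facePrime (hB : IsSimplicial B e) {b : B} :
    AddMonoidAlgebra.single b (1 : K) ∈ hB.facePrime K d ↔ b ≠ 0 := by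
  rw [facePrime, AddMonoidAlgebra.single_mem_ker_faceHom, hB.face_eq_bot, AddSubmonoid.mem_bot]

lemma var_mem_facePrime (hB : IsSimplicial B e) (i : Fin d) : hB.var K i ∈ hB.facePrime K d := by
  rw [var, single_mem_facePrime]
  intro h
  have := hB.coord_e i i
  rw [show e i = 0 from congrArg Subtype.val h, hB.coord_zero] at this
  simp at this

lemma mem_facePrime_iff (hB : IsSimplicial B e)
    {p : AddMonoidAlgebra K B} : p ∈ hB.facePrime K d ↔ p.coeff 0 = 0 := by
  rw [facePrime, AddMonoidAlgebra.mem_ker_faceHom, hB.face_eq_bot]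
  simp

/-- The maximal monomial ideal is contained in each prime which contains all `t^(e i)`. -/
lemma facePrime_le (hB : IsSimplicial B e) {Q : Ideal (AddMonoidAlgebra K B)} [hQ : Q.IsPrime]
    (h : ∀ i, hB.var K i ∈ Q) : hB.facePrime K d ≤ Q := by
  have key : ∀ b : B, b ≠ 0 → AddMonoidAlgebra.single b (1 : K) ∈ Q := fun b hb => by
    obtain ⟨N, hN, m, hm, hNm⟩ := hB.exists_single_pow_eq K b
    refine hQ.mem_of_pow_mem N ?_
    rw [hm]
    obtain ⟨i, hi⟩ : ∃ i, m i ≠ 0 := by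
      by_contra! h0
      simp only [h0, zero_smul, Finset.sum_const_zero] at hNm
      exact hb (Subtype.ext ((smul_eq_zero.1 hNm).resolve_left hN.ne'))
    exact Ideal.IsPrime.prod_mem_iff.2 ⟨i, Finset.mem_univ i, Ideal.pow_mem_of_mem _ (h i) _
      (Nat.pos_of_ne_zero hi)⟩
  intro p hp
  rw [mem_facePrime_iff] at hp
  rw [← AddMonoidAlgebra.sum_coeff_single p]
  refine Q.sum_mem fun b hb => ?_
  have hb0 : b ≠ 0 := fun h => Finsupp.mem_support_iff.1 hb (h ▸ hp)
  have := Q.mul_mem_left (algebraMap K _ (p.coeff b)) (key b hb0)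
  simpa [AddMonoidAlgebra.single_mul_single] using this

/-- If `K[B]` is Cohen-Macaulay, equivalent elements of `B_A` are equal. -/
theorem eq_of_equivalent_of_isCohenMacaulayRing (hB : IsSimplicial B e)
    (hCM : IsCohenMacaulayRing (AddMonoidAlgebra K B)) {x y : Fin n → ℤ}
    (hx : x ∈ minimalSet B e) (hy : y ∈ minimalSet B e) (hxy : Equivalent e x y) : x = y := by
  classical
  have hNoeth := hB.isNoetherianRing K
  obtain ⟨c, hc⟩ := hxy.exists_int
  -- The negative and positive parts of `c` have disjoint supports.
  set p : Fin d → ℕ := fun i => (-c i).toNat with hp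
  set q : Fin d → ℕ := fun i => (c i).toNat with hq
  have hpq : x + ∑ i, p i • e i = y + ∑ i, q i • e i := by
    have h1 : ∀ i, c i • e i = q i • e i - p i • e i := fun i => by
      rw [← natCast_zsmul, ← natCast_zsmul, ← sub_smul]
      congr 1
      simp only [hp, hq]
      omega
    rw [Finset.sum_congr rfl fun i _ => h1 i, Finset.sum_sub_distrib] at hc
    rw [← sub_add_cancel x y, hc]
    abel
  by_contra hne
  have hp0 : p ≠ 0 := fun h => hne <| by
    rw [h] at hpq
    have hxq : x = y + ∑ i, q i • e i := by simpa using hpq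
    have hq0 : q = 0 := hB.eq_zero_of_add_mem_minimalSet hy.1 (hxq ▸ hx)
    rw [hq0] at hxq
    simpa using hxq
  set m := hB.facePrime K d
  set R := Localization.AtPrime m
  have hR : IsNoetherianRing R := IsLocalization.isNoetherianRing m.primeCompl R hNoeth
  set v : Fin d → R := fun i => algebraMap _ R (hB.var K i) with hv
  have hvm : ∀ i, v i ∈ IsLocalRing.maximalIdeal R := fun i =>
    (IsLocalization.AtPrime.to_map_mem_maximal_iff R m _).2 (hB.var_mem_facePrime K i)
  have hdimR : (d : WithBot ℕ∞) ≤ ringKrullDim R := by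
    rw [IsLocalization.AtPrime.ringKrullDim_eq_height m R]
    exact WithBot.coe_le_coe.2 (hB.le_height_facePrime K le_rfl)
  have hd : 0 < d := by
    by_contra h
    obtain rfl : d = 0 := by omega
    exact hp0 (Subsingleton.elim _ _)
  obtain ⟨rs, hlen, hmem, hrs⟩ := (hCM.2 m).exists_isRegular (k := d - 1)
    (lt_of_lt_of_le (by exact_mod_cast Nat.sub_lt hd one_pos) hdimR)
  set a : R := ∏ i, v i ^ p i with ha
  set b : R := ∏ i, v i ^ q i with hb
  have hmap : ∀ m' : Fin d → ℕ, ∏ i, v i ^ m' i =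
      algebraMap _ R (AddMonoidAlgebra.single (⟨∑ i, m' i • e i, hB.sum_mem m'⟩ : B) (1 : K)) :=
    fun m' => by
    rw [← hB.prod_var_pow K, map_prod]
    simp [hv]
  have hmem_of_prod : ∀ (Q : Ideal R) [Q.IsPrime] (m' : Fin d → ℕ), ∏ i, v i ^ m' i ∈ Q →
      ∃ i, m' i ≠ 0 ∧ v i ∈ Q := fun Q hQ m' h => by
    obtain ⟨i, -, hi⟩ := Ideal.IsPrime.prod_mem_iff.1 h
    refine ⟨i, fun h0 => ?_, hQ.mem_of_pow_mem _ hi⟩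
    rw [h0, pow_zero] at hi
    exact hQ.ne_top ((Ideal.eq_top_iff_one _).2 hi)
  have ham : a ∈ IsLocalRing.maximalIdeal R := by
    obtain ⟨i, hi⟩ := Function.ne_iff.1 hp0
    exact Ideal.IsPrime.prod_mem_iff.2 ⟨i, Finset.mem_univ i, Ideal.pow_mem_of_mem _ (hvm i) _
      (Nat.pos_of_ne_zero hi)⟩
  have : IsDomain R := IsLocalization.isDomain_localization m.primeCompl_le_nonZeroDivisors
  have ha0 : a ≠ 0 := by
    rw [ha, hmap, ne_eq, IsLocalization.to_map_eq_zero_iff R m.primeCompl_le_nonZeroDivisors]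
    simp
  have hcancel : algebraMap _ R (AddMonoidAlgebra.single (⟨y, hy.1⟩ : B) (1 : K)) ∈
      Ideal.span {a} := by
    refine mem_span_of_mul_mem_span (b := b) ham
      (fun r s h => mul_left_cancel₀ ha0 h) (k := rs.length - 1) (by omega) hmem hrs ?_ ?_
    · intro P hP haP hbP
      obtain ⟨i, hi, hiP⟩ := hmem_of_prod P p haP
      obtain ⟨j, hj, hjP⟩ := hmem_of_prod P q hbP
      have hij : i ≠ j := by
        rintro rfl
        simp only [hp, hq] at hi hj
        omega
      -- Modulo `P` two of the `t^(e i)` vanish; the other `d - 2` generate the maximal ideal up to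
      -- radical.
      have hcard : (((Finset.univ.erase i).erase j).image v).card ≤ d - 2 := by
        refine Finset.card_image_le.trans ?_
        rw [Finset.card_erase_of_mem (Finset.mem_erase.2 ⟨hij.symm, Finset.mem_univ j⟩),
          Finset.card_erase_of_mem (Finset.mem_univ i), Finset.card_fin]
        omega
      have hd2 : 2 ≤ d := by
        by_contra h
        exact hij (Fin.ext (by omega))
      refine (ringKrullDim_quotient_le_card P (((Finset.univ.erase i).erase j).image v)
        ?_ ?_).trans_lt ?_
      · intro r hr
        obtain ⟨l, -, rfl⟩ := Finset.mem_image.1 hr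
        exact hvm l
      · intro Q hQ hPQ hvQ
        have hall : ∀ l, v l ∈ Q := fun l => by
          by_cases hli : l = i
          · exact hli ▸ hPQ hiP
          · by_cases hlj : l = j
            · exact hlj ▸ hPQ hjP
            · exact hvQ _ (Finset.mem_image_of_mem _ (by simp [hli, hlj]))
        rw [← IsLocalization.AtPrime.map_eq_maximalIdeal m R, Ideal.map_le_iff_le_comap]
        exact hB.facePrime_le K hall
      · exact_mod_cast hcard.trans_lt (by omega)
    · have : b * algebraMap _ R (AddMonoidAlgebra.single (⟨y, hy.1⟩ : B) (1 : K)) =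
          a * algebraMap _ R (AddMonoidAlgebra.single (⟨x, hx.1⟩ : B) (1 : K)) := by
        rw [ha, hb, hmap, hmap, ← map_mul, ← map_mul, AddMonoidAlgebra.single_mul_single,
          AddMonoidAlgebra.single_mul_single]
        congr 2
        ext1
        simp only [AddSubmonoid.coe_add]
        rw [add_comm, ← hpq, add_comm]
      rw [this]
      exact Ideal.mul_mem_right _ _ (Ideal.mem_span_singleton_self a)
  -- Clearing denominators gives `s * t^y ∈ (t^p)` in `K[B]` with `s` of nonzero constant
  -- coefficient. This is the coefficient of `s * t^y` at `y`, so `y` lies in `B` plus the exponent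
  -- of `t^p`.
  rw [ha, hmap, ← Set.image_singleton, ← Ideal.map_span,
    IsLocalization.algebraMap_mem_map_algebraMap_iff m.primeCompl] at hcancel
  obtain ⟨s, hs, hsy⟩ := hcancel
  obtain ⟨w, hw⟩ := Ideal.mem_span_singleton'.1 hsy
  have hs0 : s.coeff 0 ≠ 0 := fun h => hs ((hB.mem_facePrime_iff K).2 h)
  have hcoeff := congrArg (fun f => f.coeff ⟨y, hy.1⟩) hw
  have h2 := s.coeff_mul_single_add 1 (⟨y, hy.1⟩ : B) 0
  rw [zero_add, mul_one] at h2
  simp only [h2] at hcoeff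
  refine hs0 (hcoeff ▸ AddMonoidAlgebra.coeff_mul_single_of_forall_add_ne _ _ fun z hz => ?_)
  have hyz : y = z + ∑ i, p i • e i := (congrArg Subtype.val hz).symm
  exact hp0 (hB.eq_zero_of_add_mem_minimalSet z.2 (hyz ▸ hy))

end IsSimplicial

end AffineSemigroup

/-! ### Freeness over the polynomial ring, and 3 implies 1. -/

namespace CohenMacaulay

/-- The depth of a Noetherian local ring is at most its dimension. -/
lemma depth_le_ringKrullDim {R : Type*} [CommRing R] [IsNoetherianRing R] [IsLocalRing R] :
    (depth R : WithBot ℕ∞) ≤ ringKrullDim R := by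
  rw [← IsLocalRing.maximalIdeal_height_eq_ringKrullDim, WithBot.coe_le_coe]
  refine iSup₂_le fun rs hrs => ?_
  rw [← WithBot.coe_le_coe, IsLocalRing.maximalIdeal_height_eq_ringKrullDim,
    ← ringKrullDim_add_length_eq_ringKrullDim_of_isRegular rs hrs.2]
  have : Nontrivial (R ⧸ Ideal.ofList rs) := Ideal.Quotient.nontrivial_iff.2 fun h =>
    hrs.2.2 (by rw [h, smul_eq_mul, Ideal.mul_top])
  exact le_add_of_nonneg_left ringKrullDim_nonneg_of_nontrivial

lemma length_le_depth {R : Type*} [CommRing R] [IsLocalRing R] {rs : List R}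
    (hmem : ∀ r ∈ rs, r ∈ IsLocalRing.maximalIdeal R) (hrs : IsRegular R rs) :
    (rs.length : ℕ∞) ≤ depth R :=
  le_iSup₂_of_le rs ⟨hmem, hrs⟩ le_rfl

end CohenMacaulay

namespace AffineSemigroup

variable {n d : ℕ} {B : AddSubmonoid (Fin n → ℤ)} {e : Fin d → Fin n → ℤ}

namespace IsSimplicial

variable (K : Type*) [Field K]

/-- The decomposition of `B` into translates of `A`, when each class consists of one element. -/
def decompEquiv (hB : IsSimplicial B e)
    (hH : ∀ x ∈ minimalSet B e, ∀ y ∈ minimalSet B e, Equivalent e x y → x = y) :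
    (Σ _ : minimalSet B e, Fin d →₀ ℕ) ≃ B :=
  Equiv.ofBijective (fun s => ⟨s.1 + ∑ i, s.2 i • e i, B.add_mem s.1.2.1 (hB.sum_mem _)⟩) (by
    constructor
    · rintro ⟨⟨x, hx⟩, v⟩ ⟨⟨y, hy⟩, w⟩ h
      have h' : x + ∑ i, v i • e i = y + ∑ i, w i • e i := congrArg Subtype.val h
      have hxy : Equivalent e x y :=
        ((equivalent_add_sum x v).symm.trans (by rw [h']; exact .refl _)).trans
          (equivalent_add_sum y w)
      obtain rfl := hH x hx y hy hxy
      have hvw : v = w := DFunLike.coe_injective (hB.sum_nsmul_injective (add_left_cancel h'))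
      rw [hvw]
    · rintro ⟨x, hx⟩
      obtain ⟨y, hy, m, rfl⟩ := hB.exists_minimal_add hx
      exact ⟨⟨⟨y, hy⟩, Finsupp.equivFunOnFinite.symm m⟩, by simp⟩)

/-- If each class consists of one element, then `K[B]` is free over the polynomial ring
`K[A] = K[X₁, …, X_d]`. -/
lemma free_of_forall_eq (hB : IsSimplicial B e)
    (hH : ∀ x ∈ minimalSet B e, ∀ y ∈ minimalSet B e, Equivalent e x y → x = y) :
    letI := (MvPolynomial.aeval (R := K) (hB.var K)).toAlgebra
    Module.Free (MvPolynomial (Fin d) K) (AddMonoidAlgebra K B) := by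
  let := (MvPolynomial.aeval (R := K) (hB.var K)).toAlgebra
  have : IsScalarTower K (MvPolynomial (Fin d) K) (AddMonoidAlgebra K B) :=
    .of_algebraMap_eq fun r => (AlgHom.commutes (MvPolynomial.aeval (R := K) (hB.var K)) r).symm
  let Φ : (minimalSet B e →₀ MvPolynomial (Fin d) K) →ₗ[MvPolynomial (Fin d) K]
      AddMonoidAlgebra K B :=
    Finsupp.linearCombination _ fun x => AddMonoidAlgebra.single (⟨x, x.2.1⟩ : B) (1 : K)
  let b₁ := Finsupp.basis fun _ : minimalSet B e => MvPolynomial.basisMonomials (Fin d) K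
  let b₂ : Module.Basis B K (AddMonoidAlgebra K B) := .ofRepr (AddMonoidAlgebra.coeffLinearEquiv K)
  -- Over `K`, `Φ` carries a basis to the monomial basis, reindexed along `decompEquiv`.
  have hΦ : Φ.restrictScalars K = (b₁.equiv b₂ (hB.decompEquiv hH)).toLinearMap := by
    refine b₁.ext fun ⟨x, v⟩ => ?_
    simp only [LinearEquiv.coe_coe, Module.Basis.equiv_apply]
    have h1 : b₂ (hB.decompEquiv hH ⟨x, v⟩) =
        AddMonoidAlgebra.single (hB.decompEquiv hH ⟨x, v⟩) 1 := rfl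
    have h2 : (MvPolynomial.monomial v (1 : K)) • AddMonoidAlgebra.single (⟨x, x.2.1⟩ : B) (1 : K) =
        AddMonoidAlgebra.single ⟨∑ i, v i • e i, hB.sum_mem v⟩ 1 *
          AddMonoidAlgebra.single (⟨x, x.2.1⟩ : B) (1 : K) := by
      rw [Algebra.smul_def, ← hB.prod_var_pow K]
      change MvPolynomial.aeval (hB.var K) _ * _ = _
      rw [MvPolynomial.aeval_monomial, map_one, one_mul, Finsupp.prod_fintype _ _ (by simp)]
    rw [h1]
    simp only [b₁, Finsupp.coe_basis, MvPolynomial.coe_basisMonomials,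
      LinearMap.coe_restrictScalars,
      Φ, Finsupp.linearCombination_single]
    rw [h2, AddMonoidAlgebra.single_mul_single, mul_one]
    congr 1
    exact Subtype.ext (add_comm _ _)
  have hbij : Function.Bijective Φ := by
    have := (b₁.equiv b₂ (hB.decompEquiv hH)).bijective
    rwa [← LinearEquiv.coe_coe, ← hΦ] at this
  exact .of_equiv (LinearEquiv.ofBijective Φ hbij)

/-- A prime of `K[B]` modulo which all the `t^(e i)` are integral over `K` is maximal. -/
lemma isMaximal_of_isIntegral (hB : IsSimplicial B e) {P : Ideal (AddMonoidAlgebra K B)} [P.IsPrime]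
    (h : ∀ i, IsIntegral K (Ideal.Quotient.mk P (hB.var K i))) : P.IsMaximal := by
  have hint : Algebra.IsIntegral K (AddMonoidAlgebra K B ⧸ P) := ⟨fun z => by
    obtain ⟨p, rfl⟩ := Ideal.Quotient.mk_surjective z
    induction p using AddMonoidAlgebra.induction_linear with
    | zero => rw [map_zero]; exact isIntegral_zero
    | add p q hp hq => rw [map_add]; exact hp.add hq
    | single b r =>
      obtain ⟨N, hN, m, hm, -⟩ := hB.exists_single_pow_eq K b
      have h1 : IsIntegral K (Ideal.Quotient.mk P (AddMonoidAlgebra.single b (1 : K))) := by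
        refine .of_pow hN ?_
        rw [← map_pow, hm, map_prod]
        refine IsIntegral.prod _ fun i _ => ?_
        rw [map_pow]
        exact (h i).pow _
      have h2 : AddMonoidAlgebra.single b r = r • AddMonoidAlgebra.single b (1 : K) := by
        simp
      rw [h2]
      exact h1.smul r⟩
  exact Ideal.Quotient.maximal_of_isField _ (isField_of_isIntegral_of_isField' (Field.toIsField K))

/-- If equivalent elements of `B_A` are equal, then `K[B]` is Cohen-Macaulay. -/
theorem isCohenMacaulayRing_of_forall_eq (hB : IsSimplicial B e)
    (hH : ∀ x ∈ minimalSet B e, ∀ y ∈ minimalSet B e, Equivalent e x y → x = y) :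
    IsCohenMacaulayRing (AddMonoidAlgebra K B) := by
  classical
  have hNoeth := hB.isNoetherianRing K
  refine ⟨hNoeth, fun m hm => ?_⟩
  have hR : IsNoetherianRing (Localization.AtPrime m) :=
    IsLocalization.isNoetherianRing m.primeCompl _ hNoeth
  refine ⟨hR, le_antisymm depth_le_ringKrullDim ?_⟩
  let := (MvPolynomial.aeval (R := K) (hB.var K)).toAlgebra
  have hfree : Module.Free (MvPolynomial (Fin d) K) (AddMonoidAlgebra K B) :=
    hB.free_of_forall_eq K hH
  have hft : Algebra.FiniteType K (AddMonoidAlgebra K B) := by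
    have : AddMonoid.FG B := (AddMonoid.fg_iff_addSubmonoid_fg B).2 hB.fg
    exact AddMonoidAlgebra.finiteType_of_fg K B
  -- Zariski's lemma: the residue field at `m` is finite over `K`.
  have hint : ∀ i, IsIntegral K (Ideal.Quotient.mk m (hB.var K i)) := fun i => by
    let := Ideal.Quotient.field m
    have : Module.Finite K (AddMonoidAlgebra K B ⧸ m) :=
      finite_of_finite_type_of_isJacobsonRing K _
    exact IsIntegral.of_finite K _
  let f : Fin d → Polynomial K := fun i => minpoly K (Ideal.Quotient.mk m (hB.var K i))
  have hf : ∀ i, (f i).Monic := fun i => minpoly.monic (hint i)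
  let g : Fin d → AddMonoidAlgebra K B := fun i => Polynomial.aeval (hB.var K i) (f i)
  have haeval : ∀ (P : Ideal (AddMonoidAlgebra K B)) i, g i ∈ P ↔
      Polynomial.aeval (Ideal.Quotient.mk P (hB.var K i)) (f i) = 0 := fun P i => by
    rw [← Ideal.Quotient.eq_zero_iff_mem]
    exact Eq.congr_left (Polynomial.aeval_algHom_apply (Ideal.Quotient.mkₐ K P) _ _).symm
  have hgm : ∀ i, g i ∈ m := fun i => (haeval m i).2 (minpoly.aeval _ _)
  have hreg : IsWeaklyRegular (AddMonoidAlgebra K B) (List.ofFn g) := by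
    have h1 := (MvPolynomial.isWeaklyRegular_ofFn_aeval_X f hf).of_flat
      (S := AddMonoidAlgebra K B)
    rw [List.map_ofFn] at h1
    convert! h1 using 2
    funext i
    change g i = MvPolynomial.aeval (hB.var K) (Polynomial.aeval (MvPolynomial.X i) (f i))
    rw [← Polynomial.aeval_algHom_apply, MvPolynomial.aeval_X]
  have hreg' : IsRegular (Localization.AtPrime m)
      ((List.ofFn g).map (algebraMap _ (Localization.AtPrime m))) :=
    hreg.isRegular_of_isLocalization_of_mem _ m (by simpa [List.mem_ofFn] using hgm)
  have hdepth : (d : ℕ∞) ≤ depth (Localization.AtPrime m) := by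
    refine le_of_eq_of_le (by simp) (length_le_depth ?_ hreg')
    intro r hr
    obtain ⟨s, hs, rfl⟩ := List.mem_map.1 hr
    obtain ⟨i, rfl⟩ := List.mem_ofFn.1 hs
    exact (IsLocalization.AtPrime.to_map_mem_maximal_iff _ m _).2 (hgm i)
  have hheight : m.height ≤ d := by
    have hmin : m ∈ (Ideal.span ((Finset.univ.image g : Finset _) : Set _)).minimalPrimes := by
      refine ⟨⟨hm.isPrime, Ideal.span_le.2 ?_⟩, ?_⟩
      · simpa [Set.range_subset_iff] using hgm
      · rintro P ⟨hP, hgP⟩ hPm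
        -- Modulo any prime containing all `g i`, the `t^(e i)` are integral over `K`. Such a prime
        -- is maximal, so `m` is minimal over the `g i` and Krull's height theorem applies.
        have hPmax : P.IsMaximal := hB.isMaximal_of_isIntegral K fun i =>
          ⟨f i, hf i, (haeval P i).1 (hgP (Ideal.subset_span (by simp)))⟩
        exact (hPmax.eq_of_le hm.ne_top hPm).ge
    refine (Ideal.height_le_card_of_mem_minimalPrimes_span_finset hmin).trans ?_
    exact_mod_cast Finset.card_image_le.trans (Finset.card_fin d).le
  rw [IsLocalization.AtPrime.ringKrullDim_eq_height m]
  exact WithBot.coe_le_coe.2 (hheight.trans hdepth)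

end IsSimplicial

end AffineSemigroup
end

theorem theorem3p1 (K : Type*) [Field K] {n d : ℕ} (B : AddSubmonoid (Fin n → ℤ))
    (e : Fin d → Fin n → ℤ) (hB : IsSimplicial B e) :
    List.TFAE [
      IsCohenMacaulayRing (AddMonoidAlgebra K B),
      ∃ γ : classes B e → (Fin n → ℤ), (∀ j, γ j ∈ B) ∧
        ∀ x ∈ B, ∃ (j : classes B e) (m : Fin d → ℕ), x = γ j + ∑ i, m i • e i,
      ∀ Γ ∈ classes B e, Γ.ncard = 1,
      ∀ Γ ∈ classes B e, monomialIdeal K e Γ = ⊤] := by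
  tfae_have 1 → 3 := fun h => forall_ncard_eq_one_iff.2 fun _ hx _ hy hxy =>
    hB.eq_of_equivalent_of_isCohenMacaulayRing K h hx hy hxy
  tfae_have 3 → 1 := fun h =>
    hB.isCohenMacaulayRing_of_forall_eq K (forall_ncard_eq_one_iff.1 h)
  tfae_have 2 ↔ 3 := (exists_generators_iff hB).trans forall_ncard_eq_one_iff.symm
  tfae_have 4 ↔ 3 := (forall_monomialIdeal_eq_top_iff K hB).trans forall_ncard_eq_one_iff.symm
  tfae_finish
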